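/- Let $1 \le m \le n-1$, let $P \subset \mathbb{R}^n$ be an $n$-dimensional polytope with vertex set $\mathcal{V}(P)$, let $S \subseteq \mathcal{V}(P)$ be a set of $m+1$ vertices of $P$, and let $\Sigma = \operatorname{conv}(S)$. Call $\Sigma$ a special $m$-simplex of $P$ if the points of $S$ are affinely independent and every facet of $P$ contains exactly $m$ of the $m+1$ points of $S$. Then $\Sigma$ is a special $m$-simplex of $P$ if and only if the following two conditions hold. (a) For every affine hyperplane $H \subset \mathbb{R}^n$ with $\Sigma \subset H$ there are vertices $v, w \in \mathcal{V}(P) \setminus S$ lying strictly on different sides of $H$. (b) There is a basis polytope $Q \subset \mathbb{R}^{n-m}$ of $P$ with respect to $\Sigma$, i.e. $Q = \pi(P)$ for a surjective linear map $\pi : \mathbb{R}^n \to \mathbb{R}^{n-m}$ whose kernel is the linear subspace parallel to the affine hull of $\Sigma$, such that the complex of all faces of $P$ that contain no point of $S$ is combinatorially isomorphic to the boundary complex of $Q$ (the complex of all faces of $Q$ other than $Q$); that is, the two sets of faces (each including the empty face), partially ordered by inclusion, are isomorphic. -/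

import Mathlib

namespace SpecialSimplex

section General

variable {E : Type*} [NormedAddCommGroup E] [NormedSpace ℝ E]

/-- A polytope is the convex hull of a finite set of points. -/
def IsPolytope (P : Set E) : Prop :=
  ∃ A : Finset E, P = convexHull ℝ (A : Set E)

open Classical in
/-- The dimension of a set is the dimension of its affine hull, and `-1` for the empty set. -/
noncomputable def affDim (A : Set E) : ℤ :=
  if A = ∅ then -1 else (Module.finrank ℝ (affineSpan ℝ A).direction : ℤ)

/-- The set of vertices of a polytope. -/
def vertices (P : Set E) : Set E := P.extremePoints ℝ

/-- The face complex of `P`: all faces of `P`, including `∅` and `P` itself. -/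
def faces (P : Set E) : Set (Set E) := {F | IsExposed ℝ P F}

/-- A facet of `P` is a face whose dimension is one less than that of `P`. -/
def IsFacet (P F : Set E) : Prop :=
  F ∈ faces P ∧ affDim F = affDim P - 1

/-- The boundary complex of `P`: all faces of `P` other than `P`, including `∅`. -/
def boundaryComplex (P : Set E) : Set (Set E) := {F ∈ faces P | F ≠ P}

/-- The subcomplex of the face complex of `P` formed by the faces containing no vertex in `S`. -/
def deletion (P : Set E) (S : Finset E) : Set (Set E) := {F ∈ faces P | ∀ v ∈ S, v ∉ F}

/-- Two complexes are isomorphic if they are isomorphic as sets partially ordered by inclusion. -/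
def Isomorphic {E' : Type*} (K : Set (Set E)) (L : Set (Set E')) : Prop :=
  Nonempty (K ≃o L)

/-- `S` is the vertex set of a special `m`-simplex of `P`: its elements are `m + 1` affinely
independent vertices of `P`, and every facet of `P` contains exactly `m` of them. -/
structure IsSpecialSimplex (m : ℕ) (P : Set E) (S : Finset E) : Prop where
  subset_vertices : (S : Set E) ⊆ vertices P
  card_eq : S.card = m + 1
  affineIndependent : AffineIndependent ℝ (fun v : S => (v : E))
  facet_inter : ∀ F : Set E, IsFacet P F → ((S : Set E) ∩ F).ncard = m

/-- Every hyperplane `{x | f x = c}` containing the convex hull of `S` has vertices of `P` outside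
`S` strictly on both sides. -/
def HyperplanesSeparate (P : Set E) (S : Finset E) : Prop :=
  ∀ (f : E →L[ℝ] ℝ) (c : ℝ), f ≠ 0 → convexHull ℝ (S : Set E) ⊆ {x | f x = c} →
    ∃ v ∈ vertices P \ (S : Set E), ∃ w ∈ vertices P \ (S : Set E), c < f v ∧ f w < c

end General

/-- `Q ⊆ ℝ^(n - m)` is a basis polytope of `P ⊆ ℝ^n` with respect to `S`: the image of `P` under a
projection of `ℝ^n` onto `ℝ^(n - m)` whose kernel is the linear subspace parallel to the affine
hull of `S`. -/
def IsBasisPolytope {n : ℕ} (m : ℕ) (P : Set (EuclideanSpace ℝ (Fin n)))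
    (S : Finset (EuclideanSpace ℝ (Fin n))) (Q : Set (EuclideanSpace ℝ (Fin (n - m)))) : Prop :=
  ∃ π : EuclideanSpace ℝ (Fin n) →ₗ[ℝ] EuclideanSpace ℝ (Fin (n - m)),
    Function.Surjective π ∧
    LinearMap.ker π = (affineSpan ℝ (S : Set (EuclideanSpace ℝ (Fin n)))).direction ∧
    Q = π '' P

end SpecialSimplex

/-!
A face of `P` is the zero set on `P` of an affine function nonnegative on `P`, its *slack*.

Suppose `S` is special and `F` is a face disjoint from `S`. Each facet containing `F` misses exactly
one `s ∈ S`; the facets missing a fixed `s` meet in a face whose slack, normalized to be `1` at `s`,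
vanishes on the rest of `S`. The sum of these slacks over `S` has zero set `F` and is constant on
`S`, so it factors through the projection `π` along `S`. Hence `F = P ∩ π⁻¹(π F)` and `π F` is a
proper face of `π P`. In the other direction, `π` is constant on `S`, so the preimage of a proper
face of `π P` meeting `S` would be a proper face of `P` containing `S`, and there is none.

Conversely, condition (a) says that no proper face of `P` contains `S`, so a facet contains at most
`m` points of `S`. Removing `k` points from a facet leaves a face of dimension at least `n - 1 - k`,
while (b) bounds the dimension of a face disjoint from `S` by `n - m - 1`; so a facet contains at
least `m` points of `S`.
-/

namespace SpecialSimplex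

section Faces

variable {E : Type*} [NormedAddCommGroup E] [NormedSpace ℝ E] {A P F G : Set E}

theorem mem_faces_iff :
    F ∈ faces P ↔ ∃ f : E →ᴬ[ℝ] ℝ, (∀ x ∈ P, 0 ≤ f x) ∧ F = {x ∈ P | f x = 0} := by
  constructor
  · intro hF
    rcases F.eq_empty_or_nonempty with rfl | hne
    · exact ⟨.const ℝ E 1, by simp, by simp⟩
    obtain ⟨l, rfl⟩ := hF hne
    obtain ⟨p, hpP, hp⟩ := hne
    refine ⟨.const ℝ E (l p) - l.toContinuousAffineMap, fun x hx ↦ by simpa using hp x hx, ?_⟩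
    ext x
    suffices x ∈ P → ((∀ y ∈ P, l y ≤ l x) ↔ l p = l x) by simpa [sub_eq_zero]
    exact fun hx ↦ ⟨fun h ↦ (h p hpP).antisymm (hp x hx), fun h ↦ h ▸ hp⟩
  · rintro ⟨f, hf, rfl⟩ ⟨p, hpP, hp⟩
    have hfl : ∀ x y, f x ≤ f y ↔ (-f.contLinear) y ≤ (-f.contLinear) x := fun x y ↦ by
      have := f.contLinear_map_vsub y x
      simp only [vsub_eq_sub, map_sub] at this
      simp only [neg_apply]
      constructor <;> intro <;> linarith
    refine ⟨-f.contLinear, ?_⟩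
    ext x
    simp only [← hfl, Set.mem_ofPred_eq, and_congr_right_iff]
    exact fun hx ↦ ⟨fun h ↦ h ▸ hf, fun h ↦ ((h p hpP).trans_eq hp).antisymm (hf x hx)⟩

theorem subset_of_mem_faces (hF : F ∈ faces P) : F ⊆ P :=
  IsExposed.subset hF

theorem empty_mem_faces (P : Set E) : ∅ ∈ faces P :=
  isExposed_empty

theorem exists_slack_eq_one {s : E} (hF : F ∈ faces P) (hsP : s ∈ P) (hsF : s ∉ F) :
    ∃ f : E →ᴬ[ℝ] ℝ, (∀ x ∈ P, 0 ≤ f x) ∧ F = {x ∈ P | f x = 0} ∧ f s = 1 := by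
  obtain ⟨f, hf, rfl⟩ := mem_faces_iff.1 hF
  have hfs : f s ≠ 0 := fun h ↦ hsF ⟨hsP, h⟩
  exact ⟨(f s)⁻¹ • f, fun x hx ↦ mul_nonneg (inv_nonneg.2 (hf s hsP)) (hf x hx),
    by simp [hfs], inv_mul_cancel₀ hfs⟩

theorem nonneg_of_mem_convexHull {f : E →ᴬ[ℝ] ℝ} (hf : ∀ a ∈ A, 0 ≤ f a) :
    ∀ x ∈ convexHull ℝ A, 0 ≤ f x :=
  convexHull_min hf ((convex_Ici 0).affine_preimage f.toAffineMap)

theorem sep_convexHull_eq_convexHull_sep {f : E →ᴬ[ℝ] ℝ} (hf : ∀ a ∈ A, 0 ≤ f a) :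
    {x ∈ convexHull ℝ A | f x = 0} = convexHull ℝ {a ∈ A | f a = 0} := by
  set T := convexHull ℝ {a ∈ A | f a = 0}
  have hT : ∀ x ∈ T, f x = 0 :=
    convexHull_min (fun a ha ↦ ha.2) ((convex_singleton 0).affine_preimage f.toAffineMap)
  have hconvex : Convex ℝ {x | x ∈ T ∨ 0 < f x} := by
    refine convex_iff_forall_pos.2 fun x hx y hy a b ha hb hab ↦ ?_
    have hcomb : f (a • x + b • y) = a * f x + b * f y :=
      Convex.combo_affine_apply (f := f.toAffineMap) hab
    rcases hx with hx | hx <;> rcases hy with hy | hy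
    · exact .inl (convex_convexHull ℝ _ hx hy ha.le hb.le hab)
    · exact .inr (by rw [hcomb, hT x hx]; positivity)
    · exact .inr (by rw [hcomb, hT y hy]; positivity)
    · exact .inr (by rw [hcomb]; positivity)
  have hcover : convexHull ℝ A ⊆ {x | x ∈ T ∨ 0 < f x} := by
    refine convexHull_min (fun a ha ↦ (hf a ha).eq_or_lt'.imp_left fun h ↦ ?_) hconvex
    exact subset_convexHull ℝ _ ⟨ha, h⟩
  refine Set.Subset.antisymm (fun x ⟨hx, hfx⟩ ↦ (hcover hx).resolve_right hfx.not_gt) fun x hx ↦ ?_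
  exact ⟨convexHull_mono (Set.sep_subset _ _) hx, hT x hx⟩

theorem mem_faces_convexHull_iff :
    F ∈ faces (convexHull ℝ A) ↔
      ∃ f : E →ᴬ[ℝ] ℝ, (∀ a ∈ A, 0 ≤ f a) ∧ F = convexHull ℝ {a ∈ A | f a = 0} := by
  rw [mem_faces_iff]
  refine exists_congr fun f ↦
    ⟨fun ⟨hf, hF⟩ ↦ ?_, fun ⟨hf, hF⟩ ↦ ⟨nonneg_of_mem_convexHull hf, ?_⟩⟩
  · have hfA : ∀ a ∈ A, 0 ≤ f a := fun a ha ↦ hf a (subset_convexHull ℝ A ha)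
    exact ⟨hfA, by rw [hF, sep_convexHull_eq_convexHull_sep hfA]⟩
  · rw [hF, sep_convexHull_eq_convexHull_sep hf]

theorem IsPolytope.finite_faces (hP : IsPolytope P) : (faces P).Finite := by
  obtain ⟨A, rfl⟩ := hP
  refine (A.finite_toSet.finite_subsets.image (convexHull ℝ)).subset fun F hF ↦ ?_
  obtain ⟨f, -, rfl⟩ := mem_faces_convexHull_iff.1 hF
  exact Set.mem_image_of_mem _ (Set.sep_subset _ _)

theorem IsPolytope.of_mem_faces (hP : IsPolytope P) (hF : F ∈ faces P) : IsPolytope F := by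
  obtain ⟨A, rfl⟩ := hP
  obtain ⟨f, -, rfl⟩ := mem_faces_convexHull_iff.1 hF
  obtain ⟨B, hB⟩ := (A.finite_toSet.subset (Set.sep_subset _ fun a ↦ f a = 0)).exists_finset_coe
  exact ⟨B, by rw [hB]⟩

theorem IsPolytope.faces_subset_faces (hP : IsPolytope P) (hF : F ∈ faces P) :
    faces F ⊆ faces P := by
  intro G hG
  obtain ⟨A, rfl⟩ := hP
  obtain ⟨f, hf, rfl⟩ := mem_faces_convexHull_iff.1 hF
  obtain ⟨g, hg, rfl⟩ := mem_faces_convexHull_iff.1 hG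
  obtain ⟨N, hN⟩ : ∃ N : ℝ, ∀ a ∈ A, 0 < f a → -g a < N * f a := by
    refine Filter.Eventually.exists (f := Filter.atTop) ?_
    refine (Filter.eventually_all_finset A).2 fun a _ ↦ ?_
    by_cases hfa : 0 < f a
    · filter_upwards [(Filter.tendsto_id.atTop_mul_const hfa).eventually_gt_atTop (-g a)] with N hN
      exact fun _ ↦ hN
    · simp [hfa]
  -- A generator off `F` has positive slack for `N • f + g`; on `F` that slack is `g`.
  have hslack : ∀ a ∈ A, f a = 0 ∧ 0 ≤ g a ∨ 0 < f a ∧ 0 < (N • f + g) a := by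
    intro a ha
    rcases (hf a ha).eq_or_lt' with hfa | hfa
    · exact .inl ⟨hfa, hg a ⟨ha, hfa⟩⟩
    · exact .inr ⟨hfa, by simpa using neg_lt_iff_pos_add.1 (hN a ha hfa)⟩
  refine mem_faces_convexHull_iff.2 ⟨N • f + g, fun a ha ↦ ?_, congrArg (convexHull ℝ) ?_⟩
  · rcases hslack a ha with ⟨hfa, hga⟩ | ⟨-, hpos⟩
    · simpa [hfa] using hga
    · exact hpos.le
  · ext a
    suffices a ∈ A → ((f a = 0 ∧ g a = 0) ↔ (N • f + g) a = 0) by simpa [and_assoc]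
    intro ha
    rcases hslack a ha with ⟨hfa, -⟩ | ⟨hfa, hpos⟩
    · simp [hfa]
    · simp only [hfa.ne', hpos.ne', false_and]

theorem inter_affineSpan_of_mem_faces (hF : F ∈ faces P) :
    P ∩ (affineSpan ℝ F : Set E) = F := by
  refine Set.Subset.antisymm ?_
    (Set.subset_inter (subset_of_mem_faces hF) (subset_affineSpan ℝ F))
  obtain ⟨f, -, rfl⟩ := mem_faces_iff.1 hF
  rintro x ⟨hxP, hx⟩
  have hle : affineSpan ℝ {x ∈ P | f x = 0} ≤
      (AffineSubspace.mk' (0 : ℝ) ⊥).comap f.toAffineMap :=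
    affineSpan_le.2 fun y hy ↦ by simpa using hy.2
  exact ⟨hxP, by simpa using hle hx⟩

theorem IsPolytope.le_of_forall_vertices_le (hP : IsPolytope P) {f : E →L[ℝ] ℝ} {c : ℝ}
    (h : ∀ v ∈ vertices P, f v ≤ c) : ∀ x ∈ P, f x ≤ c := by
  obtain ⟨A, rfl⟩ := hP
  have hcompact := A.finite_toSet.isCompact_convexHull (𝕜 := ℝ)
  rw [← closure_convexHull_extremePoints hcompact (convex_convexHull ℝ _)]
  exact closure_minimal (convexHull_min h (convex_halfSpace_le f.isLinear c))
    (isClosed_le f.continuous continuous_const)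

end Faces

section Dimension

variable {E : Type*} [NormedAddCommGroup E] [NormedSpace ℝ E] {A B P F : Set E}

theorem affDim_empty : affDim (∅ : Set E) = -1 :=
  if_pos rfl

theorem affDim_of_nonempty (hA : A.Nonempty) :
    affDim A = Module.finrank ℝ (affineSpan ℝ A).direction :=
  if_neg hA.ne_empty

theorem neg_one_le_affDim (A : Set E) : -1 ≤ affDim A := by
  rcases A.eq_empty_or_nonempty with rfl | hA
  · rw [affDim_empty]
  · rw [affDim_of_nonempty hA]
    lia

theorem nonempty_of_neg_one_lt_affDim (hA : -1 < affDim A) : A.Nonempty := by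
  rw [Set.nonempty_iff_ne_empty]
  rintro rfl
  exact hA.ne' affDim_empty

variable [FiniteDimensional ℝ E]

theorem affDim_le_finrank (A : Set E) : affDim A ≤ Module.finrank ℝ E := by
  rcases A.eq_empty_or_nonempty with rfl | hA
  · rw [affDim_empty]
    lia
  · rw [affDim_of_nonempty hA]
    exact_mod_cast Submodule.finrank_le _

theorem affDim_le_of_subset_affineSpan (h : A ⊆ affineSpan ℝ B) : affDim A ≤ affDim B := by
  rcases A.eq_empty_or_nonempty with rfl | hA
  · rw [affDim_empty]
    exact neg_one_le_affDim B
  · have hB : B.Nonempty := (affineSpan_nonempty ℝ).1 (hA.mono h)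
    rw [affDim_of_nonempty hA, affDim_of_nonempty hB]
    exact_mod_cast Submodule.finrank_mono (AffineSubspace.direction_le (affineSpan_le.2 h))

theorem affDim_insert_le (A : Set E) (p : E) : affDim (insert p A) ≤ affDim A + 1 := by
  rw [affDim_of_nonempty (Set.insert_nonempty p A)]
  rcases A.eq_empty_or_nonempty with rfl | hA
  · simp [affDim_empty, direction_affineSpan]
  · rw [affDim_of_nonempty hA, ← affineSpan_insert_affineSpan, direction_affineSpan]
    exact_mod_cast finrank_vectorSpan_insert_le (affineSpan ℝ A) p

theorem affDim_lt_of_subset_of_notMem_affineSpan {x : E} (h : A ⊆ B) (hxB : x ∈ B)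
    (hxA : x ∉ affineSpan ℝ A) : affDim A < affDim B := by
  rw [affDim_of_nonempty ⟨x, hxB⟩]
  rcases A.eq_empty_or_nonempty with rfl | hA
  · rw [affDim_empty]
    lia
  rw [affDim_of_nonempty hA]
  have hlt : affineSpan ℝ A < affineSpan ℝ B :=
    (affineSpan_mono ℝ h).lt_of_not_ge fun hle ↦ hxA (hle (subset_affineSpan ℝ B hxB))
  exact_mod_cast Submodule.finrank_lt_finrank_of_lt
    (AffineSubspace.direction_lt_of_nonempty hlt ((affineSpan_nonempty ℝ).2 hA))

theorem affDim_lt_of_mem_faces_of_ssubset (hF : F ∈ faces P) (hBP : B ⊆ P) (h : F ⊂ B) :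
    affDim F < affDim B := by
  obtain ⟨x, hxB, hxF⟩ := Set.exists_of_ssubset h
  refine affDim_lt_of_subset_of_notMem_affineSpan h.subset hxB fun hx ↦ hxF ?_
  exact (inter_affineSpan_of_mem_faces hF).subset ⟨hBP hxB, hx⟩

theorem eq_zero_of_affDim_eq_finrank (hP : affDim P = Module.finrank ℝ E) {f : E →L[ℝ] ℝ} {c : ℝ}
    (hf : ∀ x ∈ P, f x = c) : f = 0 := by
  have hne : P.Nonempty := nonempty_of_neg_one_lt_affDim (by lia)
  rw [affDim_of_nonempty hne] at hP
  have htop : vectorSpan ℝ P = ⊤ := by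
    rw [← direction_affineSpan]
    exact Submodule.eq_top_of_finrank_eq (by exact_mod_cast hP)
  have hker : vectorSpan ℝ P ≤ f.ker := Submodule.span_le.2 <| by
    rintro _ ⟨x, hx, y, hy, rfl⟩
    simp [hf x hx, hf y hy]
  ext x
  exact hker (htop ▸ Submodule.mem_top)

theorem exists_continuousAffineMap_of_notMem_affineSpan {a : E} (ha : a ∉ affineSpan ℝ A) :
    ∃ g : E →ᴬ[ℝ] ℝ, (∀ x ∈ A, g x = 0) ∧ 0 < g a := by
  rcases A.eq_empty_or_nonempty with rfl | ⟨p, hp⟩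
  · exact ⟨.const ℝ E 1, by simp, by simp⟩
  have hpA := subset_affineSpan ℝ A hp
  have hap : a - p ∉ (affineSpan ℝ A).direction := fun h ↦
    ha (by simpa using AffineSubspace.vadd_mem_of_mem_direction h hpA)
  obtain ⟨l, hl, hker⟩ := Submodule.exists_le_ker_of_notMem hap
  let h : E →ᴬ[ℝ] ℝ :=
    l.toContinuousLinearMap.toContinuousAffineMap - .const ℝ E (l p)
  have hA : ∀ x ∈ A, h x = 0 := fun x hx ↦ by
    simpa [h] using hker (AffineSubspace.vsub_mem_direction (subset_affineSpan ℝ A hx) hpA)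
  have hha : h a ≠ 0 := by simpa [h] using hl
  exact ⟨h a • h, fun x hx ↦ by simp [hA x hx], mul_self_pos.2 hha⟩

end Dimension

section Facets

theorem exists_sub_mul_nonneg_and_eq_zero {α : Type*} {A : Finset α} {f g : α → ℝ}
    (hf : ∀ a ∈ A, 0 ≤ f a) (hg : ∃ a ∈ A, 0 < g a) :
    ∃ t : ℝ, (∀ a ∈ A, 0 ≤ f a - t * g a) ∧ ∃ b ∈ A, 0 < g b ∧ f b - t * g b = 0 := by
  obtain ⟨a, haA, ha⟩ := hg
  obtain ⟨b, hb, hmin⟩ := (A.filter (0 < g ·)).exists_min_image (fun x ↦ f x / g x)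
    ⟨a, Finset.mem_filter.2 ⟨haA, ha⟩⟩
  obtain ⟨hbA, hgb⟩ := Finset.mem_filter.1 hb
  refine ⟨f b / g b, fun x hx ↦ ?_, b, hbA, hgb, by field_simp; simp⟩
  rcases le_or_gt (g x) 0 with hgx | hgx
  · have := mul_nonpos_of_nonneg_of_nonpos (div_nonneg (hf b hbA) hgb.le) hgx
    linarith [hf x hx]
  · exact sub_nonneg.2 ((le_div_iff₀ hgx).1 (hmin x (Finset.mem_filter.2 ⟨hx, hgx⟩)))

variable {E : Type*} [NormedAddCommGroup E] [NormedSpace ℝ E] [FiniteDimensional ℝ E]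
  {P F : Set E} {s : E}

theorem IsPolytope.exists_face_ssuperset_notMem (hP : IsPolytope P) (hF : F ∈ faces P)
    (hsF : s ∉ F) (hdim : affDim F + 1 < affDim P) : ∃ G ∈ faces P, F ⊂ G ∧ s ∉ G := by
  obtain ⟨A, rfl⟩ := hP
  obtain ⟨f, hf, rfl⟩ := mem_faces_iff.1 hF
  have hA : ∀ a ∈ A, a ∈ convexHull ℝ (A : Set E) := fun a ha ↦ subset_convexHull ℝ _ ha
  set F := {x ∈ convexHull ℝ (A : Set E) | f x = 0}
  obtain ⟨a, haA, ha⟩ : ∃ a ∈ A, a ∉ affineSpan ℝ (insert s F) := by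
    by_contra! h
    have hle := affDim_le_of_subset_affineSpan
      (convexHull_min h (AffineSubspace.convex (affineSpan ℝ (insert s F))))
    exact (hle.trans (affDim_insert_le F s)).not_gt hdim
  obtain ⟨g, hg, hga⟩ := exists_continuousAffineMap_of_notMem_affineSpan ha
  obtain ⟨t, hnonneg, b, hbA, hgb, hzero⟩ :=
    exists_sub_mul_nonneg_and_eq_zero (fun a ha ↦ hf a (hA a ha)) ⟨a, haA, hga⟩
  refine ⟨{x ∈ convexHull ℝ (A : Set E) | (f - t • g) x = 0},
    mem_faces_iff.2 ⟨_, nonneg_of_mem_convexHull hnonneg, rfl⟩, ⟨fun x hx ↦ ?_, fun hGF ↦ ?_⟩, ?_⟩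
  · exact ⟨hx.1, by simp [hx.2, hg x (.inr hx)]⟩
  · exact hgb.ne' (hg b (.inr (hGF ⟨hA b hbA, hzero⟩)))
  · rintro ⟨hsP, hs⟩
    exact hsF ⟨hsP, by simpa [hg s (.inl rfl)] using hs⟩

theorem IsPolytope.exists_facet_superset_notMem (hP : IsPolytope P) (hF : F ∈ faces P)
    (hsP : s ∈ P) (hsF : s ∉ F) : ∃ G, IsFacet P G ∧ F ⊆ G ∧ s ∉ G := by
  have hfinite : {G ∈ faces P | s ∉ G}.Finite := hP.finite_faces.subset (Set.sep_subset _ _)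
  obtain ⟨G, hFG, ⟨hG, hsG⟩, hmax⟩ := hfinite.exists_le_maximal ⟨hF, hsF⟩
  have hlt : affDim G < affDim P := affDim_lt_of_mem_faces_of_ssubset hG subset_rfl
    ((subset_of_mem_faces hG).ssubset_of_mem_notMem hsP hsG)
  have hge : affDim P ≤ affDim G + 1 := by
    by_contra! hdim
    obtain ⟨G', hG', hGG', hsG'⟩ := hP.exists_face_ssuperset_notMem hG hsG hdim
    exact hGG'.not_subset (hmax ⟨hG', hsG'⟩ hGG'.subset)
  exact ⟨G, ⟨hG, by lia⟩, hFG, hsG⟩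

theorem IsPolytope.exists_facet_notMem (hP : IsPolytope P) (hsP : s ∈ P) :
    ∃ G, IsFacet P G ∧ s ∉ G := by
  obtain ⟨G, hG, -, hsG⟩ :=
    hP.exists_facet_superset_notMem (empty_mem_faces P) hsP (Set.notMem_empty s)
  exact ⟨G, hG, hsG⟩

theorem IsPolytope.exists_face_avoiding (hP : IsPolytope P) (hF : F ∈ faces P) (R : Finset E) :
    ∃ K ∈ faces P, K ⊆ F ∧ (∀ v ∈ R, v ∉ K) ∧ affDim F - R.card ≤ affDim K := by
  classical
  induction R using Finset.induction_on with
  | empty => exact ⟨F, hF, subset_rfl, by simp, by simp⟩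
  | insert p R hpR ih =>
    obtain ⟨K, hK, hKF, havoid, hdim⟩ := ih
    simp only [Finset.card_insert_of_notMem hpR, Finset.forall_mem_insert]
    by_cases hpK : p ∈ K
    · obtain ⟨G, hG, hpG⟩ := (hP.of_mem_faces hK).exists_facet_notMem hpK
      have hGK := subset_of_mem_faces hG.1
      refine ⟨G, hP.faces_subset_faces hK hG.1, hGK.trans hKF,
        ⟨hpG, fun v hv hvG ↦ havoid v hv (hGK hvG)⟩, ?_⟩
      rw [hG.2]
      push_cast
      lia
    · exact ⟨K, hK, hKF, ⟨hpK, havoid⟩, by push_cast; lia⟩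

end Facets

section ProperFaces

variable {E : Type*} [NormedAddCommGroup E] [NormedSpace ℝ E] {P : Set E} {S : Finset E}

/-- `S` lies in no face of `P` other than `P` itself. For a full-dimensional polytope and a nonempty
`S ⊆ P` this is the facial form of `HyperplanesSeparate`. -/
def NoProperFaceContains (P S : Set E) : Prop :=
  ∀ F ∈ faces P, S ⊆ F → F = P

theorem HyperplanesSeparate.noProperFaceContains (hsep : HyperplanesSeparate P S)
    (hS : S.Nonempty) : NoProperFaceContains P (S : Set E) := by
  intro F hF hSF
  obtain ⟨f, hf, rfl⟩ := mem_faces_iff.1 hF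
  obtain ⟨s, hs⟩ := hS
  have hlinear : ∀ x, f.contLinear x - f.contLinear s = f x := fun x ↦ by
    simpa [(hSF hs).2] using f.contLinear_map_vsub x s
  by_contra hne
  have hlinear_ne : f.contLinear ≠ 0 := fun h0 ↦ hne <| Set.sep_eq_self_iff_mem_true.2 fun x _ ↦ by
    simpa [h0] using (hlinear x).symm
  have hconst : convexHull ℝ (S : Set E) ⊆ {x | f.contLinear x = f.contLinear s} :=
    convexHull_min (fun t ht ↦ by simpa [(hSF ht).2, sub_eq_zero] using hlinear t)
      (convex_hyperplane f.contLinear.isLinear _)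
  obtain ⟨-, -, w, hw, -, hlt⟩ := hsep f.contLinear _ hlinear_ne hconst
  linarith [hf w hw.1.1, hlinear w]

theorem NoProperFaceContains.ncard_inter_facet_lt (h : NoProperFaceContains P (S : Set E))
    {F : Set E} (hF : IsFacet P F) : ((S : Set E) ∩ F).ncard < S.card := by
  have hSF : ¬ (S : Set E) ⊆ F := fun hSF ↦ by
    have := hF.2
    rw [h F hF.1 hSF] at this
    lia
  rw [← Set.ncard_coe_finset]
  exact Set.ncard_lt_ncard (Set.inter_ssubset_left_iff.2 hSF) S.finite_toSet

variable [FiniteDimensional ℝ E]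

theorem NoProperFaceContains.exists_vertex_gt (h : NoProperFaceContains P (S : Set E))
    (hP : IsPolytope P) (hdim : affDim P = Module.finrank ℝ E) (hSP : (S : Set E) ⊆ P)
    {f : E →L[ℝ] ℝ} {c : ℝ} (hf : f ≠ 0) (hS : ∀ s ∈ S, f s = c) :
    ∃ v ∈ vertices P \ (S : Set E), c < f v := by
  by_contra! hcon
  have hle : ∀ x ∈ P, f x ≤ c := hP.le_of_forall_vertices_le fun v hv ↦ by
    by_cases hvS : v ∈ S
    · exact (hS v hvS).le
    · exact hcon v ⟨hv, hvS⟩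
  have hface : {x ∈ P | f x = c} ∈ faces P :=
    mem_faces_iff.2 ⟨.const ℝ E c - f.toContinuousAffineMap, by simpa using hle,
      by ext x; simp [sub_eq_zero, eq_comm (a := c)]⟩
  have hface_eq := h _ hface fun s hs ↦ ⟨hSP hs, hS s hs⟩
  exact hf (eq_zero_of_affDim_eq_finrank hdim (Set.sep_eq_self_iff_mem_true.1 hface_eq))

theorem NoProperFaceContains.hyperplanesSeparate (h : NoProperFaceContains P (S : Set E))
    (hP : IsPolytope P) (hdim : affDim P = Module.finrank ℝ E) (hSP : (S : Set E) ⊆ P) :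
    HyperplanesSeparate P S := by
  intro f c hf hS
  have hSc : ∀ s ∈ S, f s = c := fun s hs ↦ hS (subset_convexHull ℝ _ hs)
  obtain ⟨v, hv, hcv⟩ := h.exists_vertex_gt hP hdim hSP hf hSc
  obtain ⟨w, hw, hcw⟩ := h.exists_vertex_gt hP hdim hSP (f := -f) (c := -c) (neg_ne_zero.2 hf)
    fun s hs ↦ by simp [hSc s hs]
  exact ⟨v, hv, w, hw, hcv, by simpa using hcw⟩

end ProperFaces

section SpecialSimplex

variable {E : Type*} [NormedAddCommGroup E] [NormedSpace ℝ E]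
  {P F : Set E} {S : Finset E} {m : ℕ} {s : E}

/-- The intersection of the facets of `P` that contain `F` but not `s`. If `F` misses the special
simplex `S` and `s ∈ S`, it is a face containing all points of `S` except `s`, so that its
normalized slack restricts to the barycentric coordinate of `s`. -/
def facetMeet (P F : Set E) (s : E) : Set E :=
  ⋂₀ {G | IsFacet P G ∧ F ⊆ G ∧ s ∉ G}

theorem subset_facetMeet : F ⊆ facetMeet P F s :=
  Set.subset_sInter fun _ hG ↦ hG.2.1

namespace IsSpecialSimplex

theorem subset (h : IsSpecialSimplex m P S) : (S : Set E) ⊆ P :=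
  fun _ hs ↦ (h.subset_vertices hs).1

theorem nonempty (h : IsSpecialSimplex m P S) : S.Nonempty :=
  Finset.card_pos.1 (h.card_eq ▸ m.succ_pos)

theorem exists_notMem_facet (h : IsSpecialSimplex m P S) (hF : IsFacet P F) : ∃ s ∈ S, s ∉ F := by
  by_contra! hSF
  have := h.facet_inter F hF
  rw [Set.inter_eq_left.2 hSF, Set.ncard_coe_finset, h.card_eq] at this
  lia

theorem mem_facet_of_ne (h : IsSpecialSimplex m P S) (hF : IsFacet P F) (hs : s ∈ S) (hsF : s ∉ F)
    {t : E} (ht : t ∈ S) (hts : t ≠ s) : t ∈ F := by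
  have hsub : (S : Set E) ∩ F ⊆ (S : Set E) \ {s} := fun x hx ↦ ⟨hx.1, fun hxs ↦ hsF (hxs ▸ hx.2)⟩
  have hcard : ((S : Set E) \ {s}).ncard ≤ ((S : Set E) ∩ F).ncard := by
    rw [h.facet_inter F hF, Set.ncard_sdiff_singleton_of_mem hs, Set.ncard_coe_finset, h.card_eq,
      Nat.add_sub_cancel]
  have heq := Set.eq_of_subset_of_ncard_le hsub hcard (S.finite_toSet.sdiff)
  exact (heq.superset ⟨ht, hts⟩).2

theorem mem_facetMeet_of_ne (h : IsSpecialSimplex m P S) (hs : s ∈ S) {t : E} (ht : t ∈ S)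
    (hts : t ≠ s) : t ∈ facetMeet P F s :=
  fun _ hG ↦ h.mem_facet_of_ne hG.1 hs hG.2.2 ht hts

end IsSpecialSimplex

theorem continuousAffineMap_sum_apply {ι : Type*} (R : Finset ι) (f : ι → E →ᴬ[ℝ] ℝ) (x : E) :
    (∑ i ∈ R, f i) x = ∑ i ∈ R, f i x :=
  map_sum ({ toFun := fun g ↦ g x, map_zero' := rfl, map_add' := fun _ _ ↦ rfl } :
    (E →ᴬ[ℝ] ℝ) →+ ℝ) f R

variable [FiniteDimensional ℝ E]

theorem IsPolytope.facetMeet_mem_faces (hP : IsPolytope P) (hF : F ∈ faces P) (hsP : s ∈ P)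
    (hsF : s ∉ F) : facetMeet P F s ∈ faces P := by
  have hfinite : {G | IsFacet P G ∧ F ⊆ G ∧ s ∉ G}.Finite :=
    hP.finite_faces.subset fun G hG ↦ hG.1.1
  obtain ⟨𝒢, h𝒢⟩ := hfinite.exists_finset_coe
  have hmem : ∀ G, G ∈ 𝒢 ↔ IsFacet P G ∧ F ⊆ G ∧ s ∉ G := fun G ↦ by
    rw [← Finset.mem_coe, h𝒢, Set.mem_ofPred_eq]
  obtain ⟨G, hG⟩ := hP.exists_facet_superset_notMem hF hsP hsF
  rw [facetMeet, ← h𝒢]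
  exact IsExposed.sInter ⟨G, (hmem G).2 hG⟩ fun G hG ↦ ((hmem G).1 hG).1.1

theorem IsPolytope.notMem_facetMeet (hP : IsPolytope P) (hF : F ∈ faces P) (hsP : s ∈ P)
    (hsF : s ∉ F) : s ∉ facetMeet P F s := by
  obtain ⟨G, hG⟩ := hP.exists_facet_superset_notMem hF hsP hsF
  exact fun hs ↦ hG.2.2 (hs G hG)

namespace IsSpecialSimplex

theorem noProperFaceContains (h : IsSpecialSimplex m P S) (hP : IsPolytope P) :
    NoProperFaceContains P (S : Set E) := by
  intro F hF hSF
  refine (subset_of_mem_faces hF).antisymm fun x hxP ↦ by_contra fun hxF ↦ ?_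
  obtain ⟨G, hG, hFG, -⟩ := hP.exists_facet_superset_notMem hF hxP hxF
  obtain ⟨s, hs, hsG⟩ := h.exists_notMem_facet hG
  exact hsG (hFG (hSF hs))

theorem mem_of_forall_mem_facetMeet (h : IsSpecialSimplex m P S) (hP : IsPolytope P)
    (hF : F ∈ faces P) {x : E} (hxP : x ∈ P) (hx : ∀ s ∈ S, x ∈ facetMeet P F s) : x ∈ F := by
  by_contra hxF
  obtain ⟨G, hG, hFG, hxG⟩ := hP.exists_facet_superset_notMem hF hxP hxF
  obtain ⟨s, hs, hsG⟩ := h.exists_notMem_facet hG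
  exact hxG (hx s hs G ⟨hG, hFG, hsG⟩)

theorem exists_slack_eq_one_on (h : IsSpecialSimplex m P S) (hP : IsPolytope P)
    (hF : F ∈ deletion P S) :
    ∃ f : E →ᴬ[ℝ] ℝ, (∀ x ∈ P, 0 ≤ f x) ∧ F = {x ∈ P | f x = 0} ∧ ∀ s ∈ S, f s = 1 := by
  choose! f hnonneg hmeet hone using fun s (hs : s ∈ S) ↦
    exists_slack_eq_one (hP.facetMeet_mem_faces hF.1 (h.subset hs) (hF.2 s hs)) (h.subset hs)
      (hP.notMem_facetMeet hF.1 (h.subset hs) (hF.2 s hs))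
  have hzero : ∀ s ∈ S, ∀ x ∈ facetMeet P F s, f s x = 0 := fun s hs x hx ↦
    ((hmeet s hs).subset hx).2
  refine ⟨∑ s ∈ S, f s, fun x hx ↦ ?_, ?_, fun t ht ↦ ?_⟩
  · rw [continuousAffineMap_sum_apply]
    exact Finset.sum_nonneg fun s hs ↦ hnonneg s hs x hx
  · refine Set.Subset.antisymm (fun x hx ↦ ⟨subset_of_mem_faces hF.1 hx, ?_⟩) ?_
    · rw [continuousAffineMap_sum_apply]
      exact Finset.sum_eq_zero fun s hs ↦ hzero s hs x (subset_facetMeet hx)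
    · rintro x ⟨hxP, hx⟩
      rw [continuousAffineMap_sum_apply,
        Finset.sum_eq_zero_iff_of_nonneg fun s hs ↦ hnonneg s hs x hxP] at hx
      refine h.mem_of_forall_mem_facetMeet hP hF.1 hxP fun s hs ↦ ?_
      exact (hmeet s hs).superset ⟨hxP, hx s hs⟩
  · rw [continuousAffineMap_sum_apply, Finset.sum_eq_single_of_mem t ht, hone t ht]
    exact fun s hs hst ↦ hzero s hs t (h.mem_facetMeet_of_ne hs ht hst.symm)

end IsSpecialSimplex

end SpecialSimplex

section Projection

variable {E E' : Type*} [NormedAddCommGroup E] [NormedSpace ℝ E]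
  [NormedAddCommGroup E'] [NormedSpace ℝ E'] {P F : Set E} {G : Set E'} {π : E →ₗ[ℝ] E'}

theorem apply_eq_of_mem_of_direction_le_ker {S : Set E} (hker : (affineSpan ℝ S).direction ≤ π.ker)
    {s t : E} (hs : s ∈ S) (ht : t ∈ S) : π s = π t := by
  have := hker (AffineSubspace.vsub_mem_direction (subset_affineSpan ℝ S hs)
    (subset_affineSpan ℝ S ht))
  simpa [sub_eq_zero] using this

theorem direction_affineSpan_le_ker_contLinear {S : Set E} {f : E →ᴬ[ℝ] ℝ} {c : ℝ}
    (hf : ∀ s ∈ S, f s = c) : (affineSpan ℝ S).direction ≤ f.contLinear.ker := by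
  rw [direction_affineSpan]
  refine Submodule.span_le.2 ?_
  rintro _ ⟨s, hs, t, ht, rfl⟩
  simpa [hf s hs, hf t ht] using f.contLinear_map_vsub s t

theorem exists_continuousAffineMap_comp_eq [FiniteDimensional ℝ E'] (hπ : Function.Surjective π)
    {f : E →ᴬ[ℝ] ℝ} (hker : π.ker ≤ f.contLinear.ker) : ∃ g : E' →ᴬ[ℝ] ℝ, ∀ x, g (π x) = f x := by
  obtain ⟨σ, hσ⟩ := π.exists_rightInverse_of_surjective (LinearMap.range_eq_top.2 hπ)
  refine ⟨f.comp σ.toContinuousLinearMap.toContinuousAffineMap, fun x ↦ ?_⟩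
  have hmem : σ (π x) - x ∈ π.ker := by
    simpa [sub_eq_zero] using LinearMap.congr_fun hσ (π x)
  have hzero : f.contLinear (σ (π x) - x) = 0 := hker hmem
  exact sub_eq_zero.1 ((f.contLinear_map_vsub (σ (π x)) x).symm.trans hzero)

variable [FiniteDimensional ℝ E]

theorem inter_preimage_mem_faces (hG : G ∈ faces (π '' P)) : P ∩ π ⁻¹' G ∈ faces P := by
  obtain ⟨g, hg, rfl⟩ := mem_faces_iff.1 hG
  refine mem_faces_iff.2 ⟨g.comp π.toContinuousLinearMap.toContinuousAffineMap,
    fun x hx ↦ hg _ (Set.mem_image_of_mem π hx), ?_⟩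
  ext x
  have (hx : x ∈ P) : ∃ y ∈ P, π y = π x := ⟨x, hx, rfl⟩
  simpa using fun hx _ ↦ this hx

variable {S : Finset E}

theorem NoProperFaceContains.inter_preimage_mem_deletion
    (h : NoProperFaceContains P (S : Set E)) (hSP : (S : Set E) ⊆ P)
    (hker : (affineSpan ℝ (S : Set E)).direction ≤ π.ker) (hG : G ∈ boundaryComplex (π '' P)) :
    P ∩ π ⁻¹' G ∈ deletion P S := by
  refine ⟨inter_preimage_mem_faces hG.1, fun s hs hsG ↦ hG.2 ?_⟩
  have hSG : (S : Set E) ⊆ P ∩ π ⁻¹' G := fun t ht ↦ ⟨hSP ht, by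
    rw [Set.mem_preimage, apply_eq_of_mem_of_direction_le_ker hker ht hs]
    exact hsG.2⟩
  have hPG := h _ (inter_preimage_mem_faces hG.1) hSG
  exact (subset_of_mem_faces hG.1).antisymm (Set.image_subset_iff.2 (Set.inter_eq_left.1 hPG))

variable [FiniteDimensional ℝ E'] {m : ℕ}

namespace IsSpecialSimplex

theorem exists_slack_comp (h : IsSpecialSimplex m P S) (hP : IsPolytope P)
    (hπ : Function.Surjective π) (hker : π.ker = (affineSpan ℝ (S : Set E)).direction)
    (hF : F ∈ deletion P S) :
    ∃ g : E' →ᴬ[ℝ] ℝ, (∀ x ∈ P, 0 ≤ g (π x)) ∧ F = {x ∈ P | g (π x) = 0} := by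
  obtain ⟨f, hf, hFf, hone⟩ := h.exists_slack_eq_one_on hP hF
  obtain ⟨g, hg⟩ := exists_continuousAffineMap_comp_eq hπ
    (hker.trans_le (direction_affineSpan_le_ker_contLinear hone))
  exact ⟨g, by simpa only [hg] using hf, by simpa only [hg] using hFf⟩

theorem inter_preimage_image (h : IsSpecialSimplex m P S) (hP : IsPolytope P)
    (hπ : Function.Surjective π) (hker : π.ker = (affineSpan ℝ (S : Set E)).direction)
    (hF : F ∈ deletion P S) : P ∩ π ⁻¹' (π '' F) = F := by
  obtain ⟨g, -, rfl⟩ := h.exists_slack_comp hP hπ hker hF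
  refine Set.Subset.antisymm ?_ fun x hx ↦ ⟨hx.1, Set.mem_image_of_mem π hx⟩
  rintro x ⟨hxP, y, ⟨-, hy⟩, hyx⟩
  exact ⟨hxP, hyx ▸ hy⟩

theorem image_mem_boundaryComplex (h : IsSpecialSimplex m P S) (hP : IsPolytope P)
    (hπ : Function.Surjective π) (hker : π.ker = (affineSpan ℝ (S : Set E)).direction)
    (hF : F ∈ deletion P S) : π '' F ∈ boundaryComplex (π '' P) := by
  constructor
  · obtain ⟨g, hg, rfl⟩ := h.exists_slack_comp hP hπ hker hF
    refine mem_faces_iff.2 ⟨g, Set.forall_mem_image.2 hg, ?_⟩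
    exact Set.image_inter_preimage π P {y | g y = 0}
  · intro himage
    obtain ⟨s, hs⟩ := h.nonempty
    have hsF : s ∈ P ∩ π ⁻¹' (π '' F) :=
      ⟨h.subset hs, himage ▸ Set.mem_image_of_mem π (h.subset hs)⟩
    exact hF.2 s hs (h.inter_preimage_image hP hπ hker hF ▸ hsF)

theorem isomorphic (h : IsSpecialSimplex m P S) (hP : IsPolytope P)
    (hπ : Function.Surjective π) (hker : π.ker = (affineSpan ℝ (S : Set E)).direction) :
    Isomorphic (deletion P S) (boundaryComplex (π '' P)) := by
  have hdeletion {G : Set E'} (hG : G ∈ boundaryComplex (π '' P)) : P ∩ π ⁻¹' G ∈ deletion P S :=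
    (h.noProperFaceContains hP).inter_preimage_mem_deletion h.subset hker.ge hG
  refine ⟨Equiv.toOrderIso
    { toFun := fun F ↦ ⟨π '' F, h.image_mem_boundaryComplex hP hπ hker F.2⟩
      invFun := fun G ↦ ⟨P ∩ π ⁻¹' G, hdeletion G.2⟩
      left_inv := fun F ↦ Subtype.ext (h.inter_preimage_image hP hπ hker F.2)
      right_inv := fun G ↦ Subtype.ext ?_ }
    (fun _ _ hFF ↦ Set.image_mono hFF)
    (fun _ _ hGG ↦ Set.inter_subset_inter_right P (Set.preimage_mono hGG))⟩
  exact (Set.image_inter_preimage π P G).trans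
    (Set.inter_eq_right.2 (subset_of_mem_faces G.2.1))

end IsSpecialSimplex

end Projection

section DimensionCount

variable {E E' : Type*} [NormedAddCommGroup E] [NormedSpace ℝ E] [FiniteDimensional ℝ E]
  [NormedAddCommGroup E'] [NormedSpace ℝ E'] [FiniteDimensional ℝ E']
  {P F : Set E} {Q : Set E'} {S : Finset E}

theorem affDim_le_affDim_of_strictMono {𝒦 : Set (Set E)} (hpoly : ∀ K ∈ 𝒦, IsPolytope K)
    (hfaces : ∀ K ∈ 𝒦, faces K ⊆ 𝒦) {φ : 𝒦 → Set E'} (hφ : StrictMono φ)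
    (hφQ : ∀ K, φ K ∈ faces Q) (K : 𝒦) : affDim (K : Set E) ≤ affDim (φ K) := by
  induction hd : (affDim (K : Set E) + 1).toNat using Nat.strong_induction_on generalizing K with
  | _ d ih =>
  rcases (K : Set E).eq_empty_or_nonempty with hK | ⟨s, hs⟩
  · rw [hK, affDim_empty]
    exact neg_one_le_affDim _
  · obtain ⟨G, ⟨hG, hGdim⟩, hsG⟩ := (hpoly K K.2).exists_facet_notMem hs
    have hGK : (⟨G, hfaces K K.2 hG⟩ : 𝒦) < K :=
      (subset_of_mem_faces hG).ssubset_of_mem_notMem hs hsG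
    have hlt := affDim_lt_of_mem_faces_of_ssubset (hφQ _) (subset_of_mem_faces (hφQ K)) (hφ hGK)
    have hGle := ih _ (by have := neg_one_le_affDim G; lia) ⟨G, hfaces K K.2 hG⟩ rfl
    lia

theorem IsPolytope.affDim_lt_finrank_of_isomorphic (hP : IsPolytope P)
    (hiso : Isomorphic (deletion P S) (boundaryComplex Q)) (hF : F ∈ deletion P S) :
    affDim F < Module.finrank ℝ E' := by
  obtain ⟨φ⟩ := hiso
  have hclosed : ∀ K ∈ deletion P S, faces K ⊆ deletion P S := fun K hK G hG ↦
    ⟨hP.faces_subset_faces hK.1 hG, fun v hv hvG ↦ hK.2 v hv (subset_of_mem_faces hG hvG)⟩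
  have hle := affDim_le_affDim_of_strictMono (fun K hK ↦ hP.of_mem_faces hK.1) hclosed
    ((Subtype.strictMono_coe _).comp φ.strictMono) (fun K ↦ (φ K).2.1) ⟨F, hF⟩
  obtain ⟨hface, hne⟩ := (φ ⟨F, hF⟩).2
  have hlt := affDim_lt_of_mem_faces_of_ssubset hface subset_rfl
    ((subset_of_mem_faces hface).ssubset_of_ne hne)
  exact hle.trans_lt (hlt.trans_le (affDim_le_finrank Q))

theorem IsPolytope.affDim_le_finrank_add_ncard (hP : IsPolytope P)
    (hiso : Isomorphic (deletion P S) (boundaryComplex Q)) (hF : IsFacet P F) :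
    affDim P ≤ Module.finrank ℝ E' + ((S : Set E) ∩ F).ncard := by
  classical
  obtain ⟨K, hK, hKF, havoid, hdim⟩ := hP.exists_face_avoiding hF.1 (S.filter (· ∈ F))
  have hKS : K ∈ deletion P S :=
    ⟨hK, fun v hv hvK ↦ havoid v (Finset.mem_filter.2 ⟨hv, hKF hvK⟩) hvK⟩
  have hcard : (S.filter (· ∈ F)).card = ((S : Set E) ∩ F).ncard := by
    rw [← Set.ncard_coe_finset, Finset.coe_filter]
    rfl
  have := hP.affDim_lt_finrank_of_isomorphic hiso hKS
  have := hF.2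
  lia

end DimensionCount

section LinearAlgebra

variable {K V V' : Type*} [DivisionRing K] [AddCommGroup V] [Module K V] [AddCommGroup V']
  [Module K V']

theorem exists_surjective_ker_eq [FiniteDimensional K V] [FiniteDimensional K V']
    {W : Submodule K V} (hW : Module.finrank K V' + Module.finrank K W = Module.finrank K V) :
    ∃ π : V →ₗ[K] V', Function.Surjective π ∧ π.ker = W := by
  have hquot : Module.finrank K (V ⧸ W) = Module.finrank K V' := by
    have := W.finrank_quotient_add_finrank
    lia
  let e : (V ⧸ W) ≃ₗ[K] V' := LinearEquiv.ofFinrankEq _ _ hquot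
  refine ⟨e.toLinearMap ∘ₗ W.mkQ, e.surjective.comp W.mkQ_surjective, ?_⟩
  rw [LinearEquiv.ker_comp, Submodule.ker_mkQ]

theorem affineIndependent_iff_finrank_direction {S : Finset V} {m : ℕ} (hcard : S.card = m + 1) :
    AffineIndependent K (fun v : S ↦ (v : V)) ↔
      Module.finrank K (affineSpan K (S : Set V)).direction = m := by
  rw [affineIndependent_iff_finrank_vectorSpan_eq K _ (by simpa using hcard), direction_affineSpan,
    Subtype.range_coe_subtype]
  rfl

end LinearAlgebra

end SpecialSimplex

open SpecialSimplex Module in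
theorem mainTheorem2_general {E E' : Type*} [NormedAddCommGroup E] [NormedSpace ℝ E]
    [FiniteDimensional ℝ E] [NormedAddCommGroup E'] [NormedSpace ℝ E'] [FiniteDimensional ℝ E']
    {m : ℕ} (hm : finrank ℝ E' + m = finrank ℝ E) {P : Set E} (hP : IsPolytope P)
    (hdim : affDim P = finrank ℝ E) {S : Finset E} (hS : (S : Set E) ⊆ vertices P)
    (hcard : S.card = m + 1) :
    IsSpecialSimplex m P S ↔ HyperplanesSeparate P S ∧ ∃ Q : Set E',
      (∃ π : E →ₗ[ℝ] E', Function.Surjective π ∧ π.ker = (affineSpan ℝ (S : Set E)).direction ∧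
        Q = π '' P) ∧ Isomorphic (deletion P S) (boundaryComplex Q) := by
  constructor
  · intro h
    obtain ⟨π, hπ, hker⟩ := exists_surjective_ker_eq (V' := E') <|
      ((affineIndependent_iff_finrank_direction hcard).1 h.affineIndependent).symm ▸ hm
    exact ⟨(h.noProperFaceContains hP).hyperplanesSeparate hP hdim h.subset,
      π '' P, ⟨π, hπ, hker, rfl⟩, h.isomorphic hP hπ hker⟩
  · rintro ⟨hsep, Q, ⟨π, hπ, hker, -⟩, hiso⟩
    have hrank := π.finrank_range_add_finrank_ker
    rw [LinearMap.range_eq_top.2 hπ, finrank_top, hker] at hrank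
    refine ⟨hS, hcard, (affineIndependent_iff_finrank_direction hcard).2 (by lia), fun F hF ↦ ?_⟩
    have hlt := (hsep.noProperFaceContains (Finset.card_pos.1 (by lia))).ncard_inter_facet_lt hF
    have hle := hP.affDim_le_finrank_add_ncard hiso hF
    lia

theorem mainTheorem2 (n m : ℕ) (hm : 1 ≤ m) (hmn : m ≤ n - 1)
    (P : Set (EuclideanSpace ℝ (Fin n))) (hP : SpecialSimplex.IsPolytope P)
    (hdim : SpecialSimplex.affDim P = n)
    (S : Finset (EuclideanSpace ℝ (Fin n)))
    (hS : (S : Set (EuclideanSpace ℝ (Fin n))) ⊆ SpecialSimplex.vertices P)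
    (hcard : S.card = m + 1) :
    SpecialSimplex.IsSpecialSimplex m P S ↔
      SpecialSimplex.HyperplanesSeparate P S ∧
      ∃ Q : Set (EuclideanSpace ℝ (Fin (n - m))),
        SpecialSimplex.IsBasisPolytope m P S Q ∧
        SpecialSimplex.Isomorphic (SpecialSimplex.deletion P S)
          (SpecialSimplex.boundaryComplex Q) :=
  mainTheorem2_general (by simp only [finrank_euclideanSpace_fin]; lia) hP
    (by rw [hdim, finrank_euclideanSpace_fin]) hS hcard
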